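/- Let $A\in\mathbb R^{n\times n}$ with $A+A^T$ positive semidefinite, let $B,C\in\mathbb R^{n\times m}$ with $\operatorname{rank}B=\operatorname{rank}C=k$, and let $$\mathcal W=\begin{bmatrix}A&B\\-C^T&0\end{bmatrix}.$$ Then there exist real orthogonal matrices $Q,V$ of size $n+m$ and nonnegative integers $n_1=k$, $n_2,n_3,n_4$ with $n_1+n_2+n_3+n_4=n$ such that, with respect to block rows and columns of sizes $n_1,n_2,n_3,n_4,k,m-k$, $$Q^T\mathcal W V=\begin{bmatrix} A_{11}&A_{12}&A_{13}&A_{14}&B_{11}&0\\ A_{21}&A_{22}&0&0&B_{21}&0\\ -A_{13}^T&0&A_{33}&0&B_{31}&0\\ -A_{14}^T&0&0&0&B_{41}&0\\ -C_{11}^T&0&0&0&0&0\\ 0&0&0&0&0&0\end{bmatrix},$$ where $B_{11},C_{11}\in\mathbb R^{n_1\times n_1}$, $A_{22}\in\mathbb R^{n_2\times n_2}$ and $A_{33}\in\mathbb R^{n_3\times n_3}$ are invertible, $A_{33}=-A_{33}^T$, and $A_{22}$ is in staircase form. (Any block may be void.) Consequently $\mathcal W\begin{bmatrix}x\\y\end{bmatrix}=\begin{bmatrix}f\\g\end{bmatrix}$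 holds if and only if $(Q^T\mathcal WV)\,V^T\begin{bmatrix}x\\y\end{bmatrix}=Q^T\begin{bmatrix}f\\g\end{bmatrix}$. Here a square matrix $M$ is in staircase form if, for some $s\ge 0$ and a partition into blocks of sizes $d_1\ge d_2\ge\dots\ge d_s>0$, $M=R+J$ with $R=\operatorname{diag}(R_{11},0,\dots,0)$, $R_{11}=R_{11}^T$ positive definite, $J=-J^T$ block tridiagonal, and $J_{i,i-1}=[\Sigma_{i,i-1}\;\,0]$ with $\Sigma_{i,i-1}\in\mathbb R^{d_i\times d_i}$ nonsingular for $i=2,\dots,s$. Moreover, $Q$ and $V$ can be chosen with the following additional properties. 1. If $\operatorname{rank}(C^TB)=k$ (in particular if $B=C$), then $Q=\operatorname{diag}(Q_1,Q_2)$ and $V=\operatorname{diag}(Q_1,V_2)$ with $Q_1\in\mathbb R^{n\times n}$ and $Q_2,V_2\in\mathbb R^{m\times m}$ orthogonal, so that the transformation is an orthogonal congruence on the block $A$. 2. In the symmetric and the generalized case, that is if $B=C$, also $Q=V$ and $B_{21}=0$, $B_{31}=0$, $B_{41}=0$. -/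

import Mathlib

open Matrix

/-- The saddle point matrix `[[A, B], [-Cᵀ, 0]]`. -/
def saddleMatrix {n m : ℕ} (A : Matrix (Fin n) (Fin n) ℝ) (B C : Matrix (Fin n) (Fin m) ℝ) :
    Matrix (Fin n ⊕ Fin m) (Fin n ⊕ Fin m) ℝ :=
  Matrix.fromBlocks A B (-Cᵀ) 0

/-- The real square matrix `M` is in (invertible) staircase form: for some number `s` of diagonal
blocks with sizes `d 0 ≥ d 1 ≥ ⋯ ≥ d (s - 1) > 0` adding up to `N`, and after cutting `M` into
consecutive blocks of these sizes, `M = R + J` where `R = diag (R₁₁, 0, …, 0)` with `R₁₁` symmetric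
positive definite, `J` is skew-symmetric and block tridiagonal, and each subdiagonal block of `J`
has the shape `[Σ 0]` with `Σ` square and nonsingular.  (The case `s = 0` is the void matrix, and
for `s = 1` there are no subdiagonal blocks.) -/
def IsStaircase {N : ℕ} (M : Matrix (Fin N) (Fin N) ℝ) : Prop :=
  ∃ (s : ℕ) (d : Fin s → ℕ) (hd : ∑ i, d i = N)
    (R J : Matrix ((i : Fin s) × Fin (d i)) ((i : Fin s) × Fin (d i)) ℝ) (hanti : Antitone d),
    (∀ i, 0 < d i) ∧
    M.submatrix (finSigmaFinEquiv.trans (finCongr hd)) (finSigmaFinEquiv.trans (finCongr hd))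
      = R + J ∧
    -- the `(1,1)` block of `R` is symmetric positive definite, all its other blocks vanish
    (∀ i : Fin s, i.val = 0 → (Matrix.of fun a b : Fin (d i) => R ⟨i, a⟩ ⟨i, b⟩).PosDef) ∧
    (∀ (i j : Fin s) (a : Fin (d i)) (b : Fin (d j)),
      ¬ (i.val = 0 ∧ j.val = 0) → R ⟨i, a⟩ ⟨j, b⟩ = 0) ∧
    -- `J` is skew-symmetric and block tridiagonal
    Jᵀ = -J ∧
    (∀ (i j : Fin s) (a : Fin (d i)) (b : Fin (d j)),
      (i.val + 1 < j.val ∨ j.val + 1 < i.val) → J ⟨i, a⟩ ⟨j, b⟩ = 0) ∧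
    -- subdiagonal blocks are `[Σ 0]` with `Σ` nonsingular
    (∀ (i j : Fin s) (hij : i.val = j.val + 1),
      IsUnit (Matrix.of fun a b : Fin (d i) =>
        J ⟨i, a⟩ ⟨j, Fin.castLE (hanti (Fin.le_def.2 (hij ▸ Nat.le_succ j.val))) b⟩) ∧
      ∀ (a : Fin (d i)) (b : Fin (d j)), d i ≤ b.val → J ⟨i, a⟩ ⟨j, b⟩ = 0)

/-- Cut `{0, …, n - 1}` into four consecutive pieces of sizes `a, b, c, d`. -/
def splitFour {n a b c d : ℕ} (h : a + (b + (c + d)) = n) :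
    Fin n ≃ Fin a ⊕ (Fin b ⊕ (Fin c ⊕ Fin d)) :=
  (((Equiv.sumCongr (Equiv.refl (Fin a))
    ((Equiv.sumCongr (Equiv.refl (Fin b)) finSumFinEquiv).trans finSumFinEquiv)).trans
      finSumFinEquiv).trans (finCongr h)).symm

/-- Cut `{0, …, m - 1}` into two consecutive pieces of sizes `a, b`. -/
def splitTwo {m a b : ℕ} (h : a + b = m) : Fin m ≃ Fin a ⊕ Fin b :=
  (finSumFinEquiv.trans (finCongr h)).symm

/-- The block sizes and the blocks of a condensed form, for matrices of size `n + m`.  The first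
and the fifth block row and column have size `n₁`, and the last one has size `l`. -/
structure CondensedBlocks (n m n₁ : ℕ) where
  (n₂ n₃ n₄ l : ℕ)
  hn : n₁ + (n₂ + (n₃ + n₄)) = n
  hm : n₁ + l = m
  A₁₁ : Matrix (Fin n₁) (Fin n₁) ℝ
  A₁₂ : Matrix (Fin n₁) (Fin n₂) ℝ
  A₁₃ : Matrix (Fin n₁) (Fin n₃) ℝ
  A₁₄ : Matrix (Fin n₁) (Fin n₄) ℝ
  A₂₁ : Matrix (Fin n₂) (Fin n₁) ℝ
  A₂₂ : Matrix (Fin n₂) (Fin n₂) ℝ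
  A₃₃ : Matrix (Fin n₃) (Fin n₃) ℝ
  B₁₁ : Matrix (Fin n₁) (Fin n₁) ℝ
  B₂₁ : Matrix (Fin n₂) (Fin n₁) ℝ
  B₃₁ : Matrix (Fin n₃) (Fin n₁) ℝ
  B₄₁ : Matrix (Fin n₄) (Fin n₁) ℝ
  C₁₁ : Matrix (Fin n₁) (Fin n₁) ℝ

/-- The `6 × 6` block matrix
```
   A₁₁    A₁₂   A₁₃   A₁₄   B₁₁   0
   A₂₁    A₂₂   0     0     B₂₁   0
  -A₁₃ᵀ   0     A₃₃   0     B₃₁   0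
  -A₁₄ᵀ   0     0     0     B₄₁   0
  -C₁₁ᵀ   0     0     0     0     0
   0      0     0     0     0     0
``` -/
def CondensedBlocks.toMatrix {n m n₁ : ℕ} (D : CondensedBlocks n m n₁) :
    Matrix (Fin n ⊕ Fin m) (Fin n ⊕ Fin m) ℝ :=
  (Matrix.fromBlocks
    (Matrix.fromBlocks
      D.A₁₁ (Matrix.fromCols D.A₁₂ (Matrix.fromCols D.A₁₃ D.A₁₄))
      (Matrix.fromRows D.A₂₁ (Matrix.fromRows (-D.A₁₃ᵀ) (-D.A₁₄ᵀ)))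
      (Matrix.fromBlocks D.A₂₂ 0 0 (Matrix.fromBlocks D.A₃₃ 0 0 0)))
    (Matrix.fromCols
      (Matrix.fromRows D.B₁₁ (Matrix.fromRows D.B₂₁ (Matrix.fromRows D.B₃₁ D.B₄₁))) 0)
    (Matrix.fromRows (Matrix.fromCols (-D.C₁₁ᵀ) 0) 0)
    0).submatrix
      (Equiv.sumCongr (splitFour D.hn) (splitTwo D.hm))
      (Equiv.sumCongr (splitFour D.hn) (splitTwo D.hm))

/-- The properties of the blocks: `B₁₁`, `C₁₁`, `A₂₂`, `A₃₃` are invertible, `A₃₃` is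
skew-symmetric and `A₂₂` is in staircase form. -/
structure CondensedBlocks.IsCondensed {n m n₁ : ℕ} (D : CondensedBlocks n m n₁) : Prop where
  isUnit_B₁₁ : IsUnit D.B₁₁
  isUnit_C₁₁ : IsUnit D.C₁₁
  isUnit_A₂₂ : IsUnit D.A₂₂
  isUnit_A₃₃ : IsUnit D.A₃₃
  skew_A₃₃ : D.A₃₃ = -D.A₃₃ᵀ
  staircase_A₂₂ : IsStaircase D.A₂₂

/-!
The case `rank (Cᵀ B) = k` carries the structure.  Split `ℝⁿ` into the range of `C` and its orthogonal
complement, and compress `A` to this complement.  The compression is again an operator `T = S + K`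
with `S` positive semidefinite and `K` skew-symmetric.  The Krylov subspaces
`range S + K (range S) + ⋯` increase to a subspace `U` that is invariant under `S` and `K`.
The orthogonal differences of consecutive Krylov subspaces are the layers of the staircase form:
`K` couples only neighbouring layers, its component from each layer to the next is surjective, and
`S` lives on the first layer, where it is positive definite.  On `U` the operator `T` is injective,
since a vector of its kernel is orthogonal to the range of `S` and to `K U`.  On `Uᗮ` the operator
`T` equals `K` and splits into an invertible skew-symmetric part and a zero part.  These facts are
`exists_orthonormal_isStaircase` and `exists_orthonormalBasis_accretive`.  The zeros of the condensed
form in the block row and column of `B` and `C` come from bases of `ℝᵐ` adapted to the kernels of `B`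
and `C`; the relation between the first block row and column of `A` holds because a positive
semidefinite form that vanishes at a vector annihilates it; and `B₁₁` is invertible because the range
of `B` meets the orthogonal complement of the range of `C` trivially.  If `B = C` the two bases of
`ℝᵐ` coincide and the range of `B` is the first block itself.

If `rank (Cᵀ B) < k`, then `B ≠ C`, and the congruence would produce a singular `B₁₁`.  The
transformations from the left and from the right are then independent of each other, and only the
singular values of the saddle point matrix matter: its rank lies between `2 k` and `n + k`, which
leaves exactly the room needed for a condensed form whose blocks `B₁₁`, `C₁₁`, `A₂₂` are diagonal
(`exists_condensed_singular`).
-/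

section Preparation

open Module Submodule
open scoped InnerProductSpace

/-! ### Orthonormal bases adapted to subspaces -/

section OrthonormalBases

variable {E : Type*} [NormedAddCommGroup E] [InnerProductSpace ℝ E]

theorem OrthonormalBasis.span_range_coe {ι : Type*} [Fintype ι] {K : Submodule ℝ E}
    (b : OrthonormalBasis ι ℝ K) : span ℝ (Set.range fun i => (b i : E)) = K := by
  have h := b.toBasis.span_eq
  apply_fun Submodule.map (Submodule.subtype _) at h
  rw [Submodule.map_span, ← Set.range_comp, Submodule.map_top, Submodule.range_subtype] at h
  simpa [Function.comp_def] using h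

/-- An orthonormal family spanning `U` and an orthonormal basis of `Uᗮ` together form an orthonormal
basis of the whole space. -/
theorem exists_orthonormalBasis_sum {ι κ : Type*} [Fintype ι] [Fintype κ]
    [FiniteDimensional ℝ E] {v : ι → E} (hv : Orthonormal ℝ v) {U : Submodule ℝ E}
    (hU : span ℝ (Set.range v) = U) (c : OrthonormalBasis κ ℝ Uᗮ) :
    ∃ q : OrthonormalBasis (ι ⊕ κ) ℝ E, (∀ i, q (.inl i) = v i) ∧ ∀ j, q (.inr j) = c j := by
  subst hU
  have hc : Orthonormal ℝ fun j => (c j : E) :=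
    c.orthonormal.comp_linearIsometry (subtypeₗᵢ _)
  have hvc : ∀ i j, ⟪v i, (c j : E)⟫_ℝ = 0 := fun i j =>
    (c j).2 _ (subset_span ⟨i, rfl⟩)
  have hspan := c.span_range_coe
  have ho : Orthonormal ℝ (Sum.elim v fun j => (c j : E)) := by
    constructor
    · rintro (i | j)
      · exact hv.1 i
      · exact hc.1 j
    · rintro (i | j) (i' | j') h
      · exact hv.2 fun e => h (e ▸ rfl)
      · exact hvc i j'
      · rw [real_inner_comm]; exact hvc i' j
      · exact hc.2 fun e => h (e ▸ rfl)
  refine ⟨OrthonormalBasis.mk ho ?_, fun i => by rw [OrthonormalBasis.coe_mk]; rfl,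
    fun j => by rw [OrthonormalBasis.coe_mk]; rfl⟩
  rw [Set.Sum.elim_range, span_union, hspan, sup_orthogonal_of_hasOrthogonalProjection]

theorem OrthonormalBasis.exists_sum_orthogonal {ι κ : Type*} [Fintype ι] [Fintype κ]
    [FiniteDimensional ℝ E] {K : Submodule ℝ E} (b : OrthonormalBasis ι ℝ K)
    (c : OrthonormalBasis κ ℝ Kᗮ) :
    ∃ q : OrthonormalBasis (ι ⊕ κ) ℝ E, (∀ i, q (.inl i) = b i) ∧ ∀ j, q (.inr j) = c j :=
  exists_orthonormalBasis_sum (b.orthonormal.comp_linearIsometry (subtypeₗᵢ _)) b.span_range_coe c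

/-- A subspace `W` containing `G` has an orthonormal basis whose vectors of index at least `dim G` are
orthogonal to `G` (its first `dim G` vectors then span `G`). -/
theorem exists_orthonormalBasis_adapted [FiniteDimensional ℝ E] {G W : Submodule ℝ E}
    (hGW : G ≤ W) :
    ∃ b : OrthonormalBasis (Fin (finrank ℝ W)) ℝ W,
      ∀ i, finrank ℝ G ≤ i.val → (b i : E) ∈ Gᗮ := by
  classical
  let g := stdOrthonormalBasis ℝ G
  let v : Fin (finrank ℝ W) → W := fun i =>
    if h : i.val < finrank ℝ G then ⟨g ⟨i, h⟩, hGW (g ⟨i, h⟩).2⟩ else 0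
  have hv : Orthonormal ℝ ({i : Fin (finrank ℝ W) | i.val < finrank ℝ G}.domRestrict v) := by
    have hg : Orthonormal ℝ fun i => (⟨g i, hGW (g i).2⟩ : W) :=
      g.orthonormal.comp_linearIsometry
        (⟨Submodule.inclusion hGW, fun _ => rfl⟩ : G →ₗᵢ[ℝ] W)
    have := hg.comp (fun i : {i : Fin (finrank ℝ W) | i.val < finrank ℝ G} =>
      (⟨i.1.val, i.2⟩ : Fin (finrank ℝ G))) (fun i j h => by
        apply Subtype.ext; apply Fin.ext; simpa using h)
    convert this using 1
    funext i
    have hi : i.1.val < finrank ℝ G := i.2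
    simp [v, hi]
  obtain ⟨b, hb⟩ := hv.exists_orthonormalBasis_extension_of_card_eq (by simp)
  have hlt : ∀ i : Fin (finrank ℝ W), (h : i.val < finrank ℝ G) → (b i : E) = g ⟨i, h⟩ := by
    intro i h
    rw [hb i h]
    simp [v, h]
  refine ⟨b, fun i hi => ?_⟩
  rw [← g.span_range_coe, mem_orthogonal]
  intro u hu
  induction hu using span_induction with
  | mem x hx =>
    obtain ⟨j, rfl⟩ := hx
    have hj : j.val < finrank ℝ W := j.2.trans_le (finrank_mono hGW)
    have := hlt ⟨j, hj⟩ j.2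
    change ⟪(g j : E), (b i : E)⟫_ℝ = 0
    rw [← this]
    have hne : (⟨j, hj⟩ : Fin (finrank ℝ W)) ≠ i := by
      intro h
      have : j.val = i.val := congrArg Fin.val h
      omega
    exact b.orthonormal.2 hne
  | zero => simp
  | add x y _ _ hx hy => rw [inner_add_left, hx, hy, add_zero]
  | smul a x _ hx => rw [inner_smul_left, hx, mul_zero]

end OrthonormalBases

/-! ### The Krylov flag of a skew-symmetric operator -/

section Krylov

variable {E : Type*} [NormedAddCommGroup E] [InnerProductSpace ℝ E]

/-- The Krylov subspace `F + K F + ⋯ + K ^ (j - 1) F` of an operator `K` started at a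
subspace `F`. -/
noncomputable def krylov (F : Submodule ℝ E) (K : E →ₗ[ℝ] E) : ℕ → Submodule ℝ E
  | 0 => ⊥
  | j + 1 => F ⊔ (krylov F K j).map K

/-- The `j`-th layer of the Krylov flag: the orthogonal complement of the `j`-th Krylov subspace in
the next one. -/
noncomputable def krylovLayer (F : Submodule ℝ E) (K : E →ₗ[ℝ] E) (j : ℕ) : Submodule ℝ E :=
  krylov F K (j + 1) ⊓ (krylov F K j)ᗮ

variable {F : Submodule ℝ E} {K : E →ₗ[ℝ] E}

theorem le_krylov_succ (j : ℕ) : F ≤ krylov F K (j + 1) := le_sup_left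

theorem apply_mem_krylov_succ {j : ℕ} {x : E} (hx : x ∈ krylov F K j) :
    K x ∈ krylov F K (j + 1) :=
  (le_sup_right : (krylov F K j).map K ≤ _) (mem_map_of_mem hx)

theorem krylov_mono : Monotone (krylov F K) := by
  refine monotone_nat_of_le_succ fun j => ?_
  induction j with
  | zero => exact bot_le
  | succ j ih => exact sup_le_sup_left (map_mono ih) F

theorem exists_krylov_eq_succ [FiniteDimensional ℝ E] (F : Submodule ℝ E) (K : E →ₗ[ℝ] E) :
    ∃ s, krylov F K s = krylov F K (s + 1) ∧
      ∀ j < s, krylov F K j ≠ krylov F K (j + 1) := by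
  classical
  have h : ∃ s, krylov F K s = krylov F K (s + 1) := by
    obtain ⟨s, hs⟩ := monotone_stabilizes_iff_noetherian.mpr inferInstance
      (⟨krylov F K, krylov_mono⟩ : ℕ →o Submodule ℝ E)
    exact ⟨s, hs (s + 1) s.le_succ⟩
  exact ⟨Nat.find h, Nat.find_spec h, fun j hj => Nat.find_min h hj⟩

theorem krylovLayer_le {i j : ℕ} (h : i < j) : krylovLayer F K i ≤ krylov F K j :=
  inf_le_left.trans (krylov_mono h)

theorem inner_krylov_krylovLayer {i j : ℕ} (h : i ≤ j) {x y : E} (hx : x ∈ krylov F K i)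
    (hy : y ∈ krylovLayer F K j) : ⟪x, y⟫_ℝ = 0 :=
  hy.2 x (krylov_mono h hx)

theorem inner_krylovLayer {i j : ℕ} (h : i ≠ j) {x y : E} (hx : x ∈ krylovLayer F K i)
    (hy : y ∈ krylovLayer F K j) : ⟪x, y⟫_ℝ = 0 := by
  rcases h.lt_or_gt with h | h
  · exact inner_krylov_krylovLayer le_rfl (krylovLayer_le h hx) hy
  · rw [real_inner_comm]
    exact inner_krylov_krylovLayer le_rfl (krylovLayer_le h hy) hx

theorem krylov_sup_krylovLayer [FiniteDimensional ℝ E] (j : ℕ) :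
    krylov F K j ⊔ krylovLayer F K j = krylov F K (j + 1) := by
  rw [krylovLayer, inf_comm]
  exact sup_orthogonal_inf_of_hasOrthogonalProjection (krylov_mono j.le_succ)

/-- A skew-symmetric operator couples only neighbouring layers of its Krylov flag. -/
theorem inner_apply_krylovLayer (hK : ∀ x y, ⟪K x, y⟫_ℝ = -⟪x, K y⟫_ℝ) {i j : ℕ}
    (h : i + 1 < j ∨ j + 1 < i) {x y : E} (hx : x ∈ krylovLayer F K i)
    (hy : y ∈ krylovLayer F K j) : ⟪x, K y⟫_ℝ = 0 := by
  rcases h with h | h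
  · rw [← neg_eq_zero, ← hK]
    exact inner_krylov_krylovLayer h (apply_mem_krylov_succ hx.1) hy
  · rw [real_inner_comm]
    exact inner_krylov_krylovLayer h (apply_mem_krylov_succ hy.1) hx

/-- The component of `K` from one layer to the next is surjective. -/
theorem eq_zero_of_mem_krylovLayer_succ [FiniteDimensional ℝ E] {j : ℕ} {w : E}
    (hw : w ∈ krylovLayer F K (j + 1)) (h : ∀ x ∈ krylovLayer F K j, ⟪w, K x⟫_ℝ = 0) : w = 0 := by
  have key : krylov F K (j + 2) ≤ (span ℝ {w})ᗮ := by
    refine sup_le (fun x hx => ?_) ?_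
    · rw [mem_orthogonal_singleton_iff_inner_left]
      exact inner_krylov_krylovLayer le_rfl (le_krylov_succ j hx) hw
    · rw [← krylov_sup_krylovLayer, Submodule.map_sup, sup_le_iff]
      constructor
      · rintro _ ⟨x, hx, rfl⟩
        rw [mem_orthogonal_singleton_iff_inner_left]
        exact inner_krylov_krylovLayer le_rfl (apply_mem_krylov_succ hx) hw
      · rintro _ ⟨x, hx, rfl⟩
        rw [mem_orthogonal_singleton_iff_inner_right]
        exact h x hx
  have := key hw.1
  rw [mem_orthogonal_singleton_iff_inner_right] at this
  exact inner_self_eq_zero.1 this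

/-- The projection onto the `j`-th layer of the image under `K` of the next layer.  For
skew-symmetric `K` its orthogonal complement in the `j`-th layer is the kernel of the component of `K`
from the `j`-th layer to the next one. -/
noncomputable def krylovCoupling [FiniteDimensional ℝ E] (F : Submodule ℝ E) (K : E →ₗ[ℝ] E) (j : ℕ) :
    Submodule ℝ E :=
  (krylovLayer F K (j + 1)).map ((krylovLayer F K j).starProjection.toLinearMap ∘ₗ K)

variable [FiniteDimensional ℝ E]

theorem krylovCoupling_le (j : ℕ) : krylovCoupling F K j ≤ krylovLayer F K j := by
  rintro _ ⟨x, -, rfl⟩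
  exact starProjection_apply_mem _ _

theorem inner_starProjection_apply (hK : ∀ x y, ⟪K x, y⟫_ℝ = -⟪x, K y⟫_ℝ) {j : ℕ} {x : E}
    (hx : x ∈ krylovLayer F K j) (w : E) :
    ⟪(krylovLayer F K j).starProjection (K w), x⟫_ℝ = -⟪w, K x⟫_ℝ := by
  rw [inner_starProjection_left_eq_right, starProjection_eq_self_iff.2 hx, hK]

/-- By skew-symmetry, surjectivity of the component of `K` from the `j`-th layer to the next makes the
component in the opposite direction injective. -/
theorem finrank_krylovCoupling (hK : ∀ x y, ⟪K x, y⟫_ℝ = -⟪x, K y⟫_ℝ) (j : ℕ) :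
    finrank ℝ (krylovCoupling F K j) = finrank ℝ (krylovLayer F K (j + 1)) := by
  set f := ((krylovLayer F K j).starProjection.toLinearMap ∘ₗ K)
  have hinj : Function.Injective (f ∘ₗ (krylovLayer F K (j + 1)).subtype) := by
    rw [← LinearMap.ker_eq_bot, LinearMap.ker_eq_bot']
    intro w hw
    apply Subtype.ext
    refine eq_zero_of_mem_krylovLayer_succ w.2 fun x hx => ?_
    rw [← neg_eq_zero, ← inner_starProjection_apply hK hx]
    change ⟪(f ∘ₗ (krylovLayer F K (j + 1)).subtype) w, x⟫_ℝ = 0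
    rw [hw, inner_zero_left]
  rw [← LinearMap.finrank_range_of_inj hinj, LinearMap.range_comp, range_subtype]
  rfl

/-- Vectors of the `j`-th layer orthogonal to the coupling subspace are not coupled to the next
layer; they give the zero columns in the subdiagonal blocks `[Σ 0]` of the staircase form. -/
theorem inner_apply_eq_zero_of_mem_krylovCoupling_orthogonal
    (hK : ∀ x y, ⟪K x, y⟫_ℝ = -⟪x, K y⟫_ℝ) {j : ℕ} {x w : E} (hx : x ∈ krylovLayer F K j)
    (hx' : x ∈ (krylovCoupling F K j)ᗮ) (hw : w ∈ krylovLayer F K (j + 1)) :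
    ⟪w, K x⟫_ℝ = 0 := by
  rw [← neg_eq_zero, ← inner_starProjection_apply hK hx]
  exact hx' _ (mem_map_of_mem hw)

theorem finrank_krylovLayer_antitone (hK : ∀ x y, ⟪K x, y⟫_ℝ = -⟪x, K y⟫_ℝ) :
    Antitone fun j => finrank ℝ (krylovLayer F K j) :=
  antitone_nat_of_succ_le fun j => by
    rw [← finrank_krylovCoupling hK]
    exact finrank_mono (krylovCoupling_le j)

end Krylov

/-! ### The staircase form -/

section Staircase

variable {E : Type*} [NormedAddCommGroup E] [InnerProductSpace ℝ E]

theorem LinearMap.IsPositive.apply_eq_zero_of_inner_eq_zero {S : E →ₗ[ℝ] E} (hS : S.IsPositive)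
    {x : E} (h : ⟪S x, x⟫_ℝ = 0) : S x = 0 := by
  -- the quadratic polynomial `t ↦ ⟪S (x + t • S x), x + t • S x⟫` is nonnegative
  have hd := discrim_le_zero (a := ⟪S (S x), S x⟫_ℝ) (b := 2 * ⟪S x, S x⟫_ℝ) (c := 0) fun t => by
    have h0 := hS.inner_nonneg_left (x + t • S x)
    have h1 : ⟪S (S x), x⟫_ℝ = ⟪S x, S x⟫_ℝ := hS.isSymmetric (S x) x
    simp only [map_add, map_smul, inner_add_left, inner_add_right, real_inner_smul_left,
      real_inner_smul_right, h, h1] at h0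
    linarith
  have h2 : ⟪S x, S x⟫_ℝ = 0 := by
    simp only [discrim] at hd
    nlinarith [sq_nonneg ⟪S x, S x⟫_ℝ]
  exact inner_self_eq_zero.1 h2

variable [FiniteDimensional ℝ E]

/-- As long as the Krylov flag of `K` started at `range S` grows strictly up to step `s`, the
compression of `S + K` to the `s`-th Krylov subspace is in staircase form in a suitable orthonormal
basis.  The diagonal blocks correspond to the layers of the flag, and in each layer the basis begins
with the part that is coupled to the next layer. -/
theorem exists_orthonormal_isStaircase {S K : E →ₗ[ℝ] E} (hS : S.IsPositive)
    (hK : ∀ x y, ⟪K x, y⟫_ℝ = -⟪x, K y⟫_ℝ) {s : ℕ}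
    (hs : ∀ j < s, krylov (LinearMap.range S) K j ≠ krylov (LinearMap.range S) K (j + 1)) :
    ∃ (N : ℕ) (v : Fin N → E), Orthonormal ℝ v ∧
      span ℝ (Set.range v) = krylov (LinearMap.range S) K s ∧
      IsStaircase (Matrix.of fun i j => ⟪v i, (S + K) (v j)⟫_ℝ) := by
  set F := LinearMap.range S
  set W := krylovLayer F K with hW
  choose b hb2 using fun j => exists_orthonormalBasis_adapted (krylovCoupling_le (F := F)
    (K := K) j)
  simp only [finrank_krylovCoupling hK] at hb2
  let d : Fin s → ℕ := fun i => finrank ℝ (W i)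
  let v : ((i : Fin s) × Fin (d i)) → E := fun p => b p.1 p.2
  have hvW : ∀ (i : Fin s) (a : Fin (d i)), v ⟨i, a⟩ ∈ W i := fun i a => (b i a).2
  have hv : Orthonormal ℝ v := by
    constructor
    · rintro ⟨i, a⟩
      exact (b i).orthonormal.1 a
    · rintro ⟨i, a⟩ ⟨j, c⟩ hne
      by_cases hij : i = j
      · subst hij
        exact (b i).orthonormal.2 fun h : a = c => hne (h ▸ rfl)
      · exact inner_krylovLayer (fun h => hij (Fin.ext h)) (hvW i a) (hvW j c)
  have hSW : ∀ {j : ℕ} {x : E}, 0 < j → x ∈ W j → S x = 0 := by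
    intro j x hj hx
    have hx' : S x ∈ krylov F K j := krylov_mono hj (le_krylov_succ 0 ⟨x, rfl⟩)
    refine hS.apply_eq_zero_of_inner_eq_zero ?_
    exact inner_krylov_krylovLayer le_rfl hx' hx
  refine ⟨∑ i, d i, v ∘ finSigmaFinEquiv.symm, hv.comp _ finSigmaFinEquiv.symm.injective, ?_, s, d,
    rfl, Matrix.of fun p q => ⟪v p, S (v q)⟫_ℝ, Matrix.of fun p q => ⟪v p, K (v q)⟫_ℝ,
    fun i j hij => finrank_krylovLayer_antitone hK hij, fun i => ?_, ?_, fun i hi => ?_,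
    fun i j a c hij => ?_, ?_, fun i j a c hij => ?_, fun i j hij => ⟨?_, fun a c hc => ?_⟩⟩
  · rw [Set.range_comp, finSigmaFinEquiv.symm.range_eq_univ, Set.image_univ]
    apply le_antisymm
    · rw [span_le]
      rintro _ ⟨⟨i, a⟩, rfl⟩
      exact krylovLayer_le i.2 (hvW i a)
    · have : ∀ j ≤ s, krylov F K j ≤ span ℝ (Set.range v) := by
        intro j
        induction j with
        | zero => exact fun _ => bot_le
        | succ j ih =>
          intro hj
          rw [← krylov_sup_krylovLayer]
          refine sup_le (ih (by omega)) ?_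
          rw [← (b j).span_range_coe]
          refine span_mono ?_
          rintro _ ⟨a, rfl⟩
          exact ⟨⟨⟨j, hj⟩, a⟩, rfl⟩
      exact this s le_rfl
  · have : W i ≠ ⊥ := by
      intro h
      apply hs i i.2
      rw [← krylov_sup_krylovLayer]
      change _ = _ ⊔ W i
      rw [h, sup_bot_eq]
    exact finrank_pos_iff.2 ((nontrivial_iff_ne_bot).2 this)
  · ext p q
    simp [inner_add_right]
  · -- on the first layer, which is the range of `S`, the operator `S` is positive definite
    refine Matrix.PosDef.of_dotProduct_mulVec_pos ?_ fun c hc => ?_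
    · ext a a'
      simp only [conjTranspose_apply, of_apply, star_trivial]
      rw [real_inner_comm, hS.isSymmetric]
    · set x : E := ∑ a, c a • v ⟨i, a⟩ with hx
      have hval : star c ⬝ᵥ (Matrix.of fun a a' : Fin (d i) =>
          (Matrix.of fun p q => ⟪v p, S (v q)⟫_ℝ) ⟨i, a⟩ ⟨i, a'⟩) *ᵥ c = ⟪x, S x⟫_ℝ := by
        simp only [hx, map_sum, map_smul, sum_inner, inner_sum, real_inner_smul_left,
          real_inner_smul_right, dotProduct, mulVec, Finset.mul_sum, of_apply, Pi.star_apply,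
          star_trivial]
        refine Finset.sum_congr rfl fun a _ => Finset.sum_congr rfl fun a' _ => ?_
        rw [← hS.isSymmetric (v ⟨i, a⟩), real_inner_comm]
        ring
      rw [hval]
      refine lt_of_le_of_ne (hS.inner_nonneg_right x) fun h0 => hc ?_
      have hSx := hS.apply_eq_zero_of_inner_eq_zero (hS.isSymmetric x x ▸ h0.symm)
      have hxF : x ∈ F := by
        have : x ∈ W i := sum_mem fun a _ => smul_mem _ _ (hvW i a)
        have h1 : x ∈ krylov F K (i + 1) := this.1
        rw [hi] at h1
        simpa [krylov] using h1
      obtain ⟨y, hy⟩ := hxF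
      have hx0 : x = 0 := by
        refine (inner_self_eq_zero (𝕜 := ℝ)).1 ?_
        nth_rewrite 1 [← hy]
        rw [hS.isSymmetric, hSx, inner_zero_right]
      have hli := (hv.comp (fun a : Fin (d i) => (⟨i, a⟩ : (i : Fin s) × Fin (d i)))
        (fun a a' h => by simpa using h)).linearIndependent
      funext a
      exact Fintype.linearIndependent_iff.1 hli c hx0 a
  · by_cases hj : j.val = 0
    · have hi : 0 < i.val := by omega
      simp only [of_apply]
      rw [← hS.isSymmetric, hSW hi (hvW i a), inner_zero_left]
    · simp only [of_apply]
      rw [hSW (Nat.pos_of_ne_zero hj) (hvW j c), inner_zero_right]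
  · ext p q
    change ⟪v q, K (v p)⟫_ℝ = -⟪v p, K (v q)⟫_ℝ
    rw [← hK, real_inner_comm]
  · exact inner_apply_krylovLayer hK hij (hvW i a) (hvW j c)
  · -- a left null vector of `Σ` gives a vector of the next layer that this layer does not reach
    have hW1 : ∀ a, v ⟨i, a⟩ ∈ W (j + 1) := fun a => by
      have := hvW i a
      rwa [hij] at this
    rw [← vecMul_injective_iff_isUnit, ← coe_vecMulLinear, ← LinearMap.ker_eq_bot,
      LinearMap.ker_eq_bot']
    intro c hc
    set w : E := ∑ a, c a • v ⟨i, a⟩ with hw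
    have hwW : w ∈ W (j + 1) := sum_mem fun a _ => smul_mem _ _ (hW1 a)
    have hwb : ∀ a : Fin (d j), ⟪w, K (b j a)⟫_ℝ = 0 := by
      intro a
      by_cases ha : a.val < d i
      · have := congrFun hc ⟨a, ha⟩
        simp only [coe_vecMulLinear, vecMul, dotProduct, of_apply, Pi.zero_apply] at this
        rw [hw, sum_inner, ← this]
        refine Finset.sum_congr rfl fun a' _ => ?_
        rw [real_inner_smul_left]
        rfl
      · refine inner_apply_eq_zero_of_mem_krylovCoupling_orthogonal hK (b j a).2 (hb2 j a ?_) hwW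
        have : d i = finrank ℝ (W (j + 1)) := by simp only [d]; rw [hij]
        change finrank ℝ (W (j + 1)) ≤ _
        omega
    have hw0 : w = 0 := by
      refine eq_zero_of_mem_krylovLayer_succ hwW fun x hx => ?_
      have hle : W j ≤ (span ℝ {K w})ᗮ := by
        rw [hW, ← (b j).span_range_coe, span_le]
        rintro _ ⟨a, rfl⟩
        rw [SetLike.mem_coe, mem_orthogonal_singleton_iff_inner_right, hK, hwb, neg_zero]
      have := hle hx
      rwa [mem_orthogonal_singleton_iff_inner_right, hK, neg_eq_zero] at this
    have hli := (hv.comp (fun a : Fin (d i) => (⟨i, a⟩ : (i : Fin s) × Fin (d i)))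
      (fun a a' h => by simpa using h)).linearIndependent
    funext a
    exact Fintype.linearIndependent_iff.1 hli c hw0 a
  · have hc' : finrank ℝ (W (j + 1)) ≤ c.val := by
      have : d i = finrank ℝ (W (j + 1)) := by simp only [d]; rw [hij]
      omega
    have hW1 : v ⟨i, a⟩ ∈ W (j + 1) := by
      have := hvW i a
      rwa [hij] at this
    exact inner_apply_eq_zero_of_mem_krylovCoupling_orthogonal hK (hvW j c) (hb2 j c hc') hW1

/-- A positive definite matrix is in staircase form with at most one block (no block if it is
void). -/
theorem Matrix.PosDef.isStaircase {N : ℕ} {M : Matrix (Fin N) (Fin N) ℝ} (hM : M.PosDef) :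
    IsStaircase M := by
  rcases N with _ | N
  · exact ⟨0, Fin.elim0, rfl, 0, 0, fun i => i.elim0, fun i => i.elim0,
      by ext p; exact p.1.elim0, fun i => i.elim0, fun i => i.elim0, by simp, fun i => i.elim0,
      fun i => i.elim0⟩
  · have hd : ∑ i : Fin 1, (fun _ : Fin 1 => N + 1) i = N + 1 := by simp
    refine ⟨1, fun _ => N + 1, hd, M.submatrix (finSigmaFinEquiv.trans (finCongr hd))
      (finSigmaFinEquiv.trans (finCongr hd)), 0, fun _ _ _ => le_rfl, fun _ => N.succ_pos,
      (add_zero _).symm, fun i _ => ?_, fun i j _ _ h => ?_, by simp, fun _ _ _ _ _ => rfl,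
      fun i j h => ?_⟩
    · exact hM.submatrix (e := fun a => finSigmaFinEquiv.trans (finCongr hd) ⟨i, a⟩)
        ((Equiv.injective _).comp fun a b h => by simpa using h)
    · omega
    · omega

end Staircase

/-! ### Orthogonal decomposition of an accretive operator -/

section Compression

variable {E E' : Type*} [NormedAddCommGroup E] [InnerProductSpace ℝ E]
  [NormedAddCommGroup E'] [InnerProductSpace ℝ E']

/-- The matrix of a compression is invertible as soon as no nonzero vector in the span of the `v j`
is mapped into the orthogonal complement of the span of the `w i`. -/
theorem isUnit_of_inner {ι : Type*} [Fintype ι] [DecidableEq ι] {T : E →ₗ[ℝ] E'} {v : ι → E}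
    {w : ι → E'} (hv : LinearIndependent ℝ v)
    (h : ∀ x ∈ span ℝ (Set.range v), (∀ y ∈ span ℝ (Set.range w), ⟪y, T x⟫_ℝ = 0) → x = 0) :
    IsUnit (Matrix.of fun i j => ⟪w i, T (v j)⟫_ℝ) := by
  rw [← mulVec_injective_iff_isUnit, ← coe_mulVecLin, ← LinearMap.ker_eq_bot,
    LinearMap.ker_eq_bot']
  intro c hc
  have hx : ∑ j, c j • v j ∈ span ℝ (Set.range v) :=
    sum_mem fun j _ => smul_mem _ _ (subset_span ⟨j, rfl⟩)
  have h0 : ∑ j, c j • v j = 0 := by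
    refine h _ hx fun y hy => ?_
    have hle : span ℝ (Set.range w) ≤ (span ℝ {T (∑ j, c j • v j)})ᗮ := by
      rw [span_le]
      rintro _ ⟨i, rfl⟩
      rw [SetLike.mem_coe, mem_orthogonal_singleton_iff_inner_left, map_sum, inner_sum]
      have := congrFun hc i
      simp only [mulVecLin_apply, mulVec, dotProduct, of_apply, Pi.zero_apply] at this
      rw [← this]
      refine Finset.sum_congr rfl fun j _ => ?_
      rw [map_smul, real_inner_smul_right, mul_comm]
    exact mem_orthogonal_singleton_iff_inner_left.1 (hle hy)
  funext j
  exact Fintype.linearIndependent_iff.1 hv c h0 j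

variable [FiniteDimensional ℝ E]

/-- A skew-symmetric operator splits orthogonally into an invertible part and its kernel. -/
theorem exists_orthonormalBasis_skew {K : E →ₗ[ℝ] E} (hK : ∀ x y, ⟪K x, y⟫_ℝ = -⟪x, K y⟫_ℝ) :
    ∃ (p q : ℕ) (M : Matrix (Fin p) (Fin p) ℝ) (c : OrthonormalBasis (Fin p ⊕ Fin q) ℝ E),
      IsUnit M ∧ M = -Mᵀ ∧ ∀ i j, ⟪c i, K (c j)⟫_ℝ = fromBlocks M 0 0 0 i j := by
  set X := (LinearMap.ker K)ᗮ with hX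
  let b := stdOrthonormalBasis ℝ X
  obtain ⟨c, hc1, hc2⟩ := b.exists_sum_orthogonal (stdOrthonormalBasis ℝ Xᗮ)
  have hker : ∀ j, K (c (.inr j)) = 0 := fun j => by
    have : c (.inr j) ∈ (LinearMap.ker K)ᗮᗮ := hc2 j ▸ coe_mem _
    exact (orthogonal_orthogonal (LinearMap.ker K)).le this
  refine ⟨_, _, Matrix.of fun i j => ⟪(b i : E), K (b j)⟫_ℝ, c, ?_, ?_, ?_⟩
  · refine isUnit_of_inner
      (b.orthonormal.comp_linearIsometry (subtypeₗᵢ _)).linearIndependent fun x hx h => ?_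
    simp only [b.span_range_coe] at hx h
    have hKx : K x ∈ X := fun y hy => by
      rw [← neg_eq_zero, ← hK, LinearMap.mem_ker.1 hy, inner_zero_left]
    have hKx0 : K x = 0 := inner_self_eq_zero.1 (h _ hKx)
    exact inner_self_eq_zero.1 (hx x hKx0)
  · ext i j
    change ⟪(b i : E), K (b j)⟫_ℝ = -⟪(b j : E), K (b i)⟫_ℝ
    rw [← hK, real_inner_comm]
  · rintro (i | i) (j | j)
    · rw [hc1, hc1]; rfl
    · rw [hker, inner_zero_right]; rfl
    · change ⟪c (.inr i), K (c (.inl j))⟫_ℝ = 0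
      rw [← neg_eq_zero, ← hK, hker, inner_zero_left]
    · rw [hker, inner_zero_right]; rfl

/-- An operator with positive semidefinite symmetric part is, in a suitable orthonormal basis, the
direct sum of an invertible matrix in staircase form, an invertible skew-symmetric matrix and a zero
matrix.  The first summand lives on the Krylov subspace generated by the range of the symmetric part
under the skew-symmetric part. -/
theorem exists_orthonormalBasis_accretive (T : E →ₗ[ℝ] E) (hT : ∀ x, 0 ≤ ⟪T x, x⟫_ℝ) :
    ∃ (p q r : ℕ) (M : Matrix (Fin p) (Fin p) ℝ) (M' : Matrix (Fin q) (Fin q) ℝ)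
      (b : OrthonormalBasis (Fin p ⊕ (Fin q ⊕ Fin r)) ℝ E),
      IsStaircase M ∧ IsUnit M ∧ IsUnit M' ∧ M' = -M'ᵀ ∧
      ∀ i j, ⟪b i, T (b j)⟫_ℝ = fromBlocks M 0 0 (fromBlocks M' 0 0 0) i j := by
  set S : E →ₗ[ℝ] E := (1 / 2 : ℝ) • (T + LinearMap.adjoint T) with hSdef
  set K : E →ₗ[ℝ] E := (1 / 2 : ℝ) • (T - LinearMap.adjoint T) with hKdef
  have hSK : T = S + K := by
    rw [hSdef, hKdef]
    module
  have hS : S.IsPositive := by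
    constructor
    · intro x y
      simp only [hSdef, LinearMap.smul_apply, LinearMap.add_apply, real_inner_smul_left,
        real_inner_smul_right, inner_add_left, inner_add_right, LinearMap.adjoint_inner_left,
        LinearMap.adjoint_inner_right]
      ring
    · intro x
      have := hT x
      simp only [hSdef, LinearMap.smul_apply, LinearMap.add_apply, real_inner_smul_left,
        inner_add_left, LinearMap.adjoint_inner_left, RCLike.re_to_real]
      rw [real_inner_comm (T x) x]
      linarith
  have hK : ∀ x y, ⟪K x, y⟫_ℝ = -⟪x, K y⟫_ℝ := by
    intro x y
    simp only [hKdef, LinearMap.smul_apply, LinearMap.sub_apply, real_inner_smul_left,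
      real_inner_smul_right, inner_sub_left, inner_sub_right, LinearMap.adjoint_inner_left,
      LinearMap.adjoint_inner_right]
    ring
  obtain ⟨s, hs, hs'⟩ := exists_krylov_eq_succ (LinearMap.range S) K
  obtain ⟨p, v, hv, hspan, hstair⟩ := exists_orthonormal_isStaircase hS hK hs'
  set U := krylov (LinearMap.range S) K s with hU
  -- `U` and `Uᗮ` are invariant under `K`, and `S` vanishes on `Uᗮ`
  have hSU : ∀ x, S x ∈ U := fun x => by
    rw [hs]
    exact le_krylov_succ s ⟨x, rfl⟩
  have hKU : ∀ x ∈ U, K x ∈ U := fun x hx => by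
    rw [hs]
    exact apply_mem_krylov_succ hx
  have hKU' : ∀ x ∈ Uᗮ, K x ∈ Uᗮ := fun x hx y hy => by
    rw [← neg_eq_zero, ← hK]
    exact hx _ (hKU y hy)
  have hSU' : ∀ x ∈ Uᗮ, S x = 0 := fun x hx =>
    hS.apply_eq_zero_of_inner_eq_zero (hx _ (hSU x))
  obtain ⟨q, r, M', c, hM', hM'skew, hc⟩ := exists_orthonormalBasis_skew
    (K := K.restrict hKU') fun x y => hK x y
  obtain ⟨b, hb1, hb2⟩ := exists_orthonormalBasis_sum hv hspan c
  have hbU : ∀ i, b (.inl i) ∈ U := fun i => by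
    rw [hb1, ← hspan]
    exact subset_span ⟨i, rfl⟩
  refine ⟨p, q, r, _, M', b, hstair, ?_, hM', hM'skew, ?_⟩
  · refine isUnit_of_inner hv.linearIndependent fun x hx h => ?_
    simp only [hspan] at hx h
    have hxx := h x hx
    have hKx : ⟪K x, x⟫_ℝ = 0 := by
      have := hK x x
      rw [real_inner_comm (K x) x] at this
      linarith
    have hSx : S x = 0 := by
      refine hS.apply_eq_zero_of_inner_eq_zero ?_
      rwa [real_inner_comm, LinearMap.add_apply, inner_add_left, hKx, add_zero] at hxx
    have hKx0 : K x = 0 := by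
      have := h (K x) (hKU x hx)
      rw [LinearMap.add_apply, hSx, zero_add] at this
      exact inner_self_eq_zero.1 this
    -- now `x` is orthogonal to `range S + K U`, which is all of `U`
    have hle : krylov (LinearMap.range S) K (s + 1) ≤ (span ℝ {x})ᗮ := by
      refine sup_le ?_ ?_
      · rintro _ ⟨y, rfl⟩
        rw [mem_orthogonal_singleton_iff_inner_left, hS.isSymmetric, hSx, inner_zero_right]
      · rintro _ ⟨y, -, rfl⟩
        rw [mem_orthogonal_singleton_iff_inner_left, hK, hKx0, inner_zero_right, neg_zero]
    rw [← hs] at hle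
    exact inner_self_eq_zero.1 (mem_orthogonal_singleton_iff_inner_left.1 (hle hx))
  · rintro (i | i) (j | j)
    · rw [hb1, hb1, hSK]; rfl
    · rw [hSK, LinearMap.add_apply, hb2, hSU' _ (coe_mem _), zero_add]
      exact hKU' _ (coe_mem _) _ (hbU i)
    · rw [hSK, LinearMap.add_apply, hb2, real_inner_comm]
      exact (c i).2 _ (add_mem (hSU _) (hKU _ (hbU j)))
    · rw [hSK, LinearMap.add_apply, hb2, hb2, hSU' _ (coe_mem _), zero_add]
      exact hc i j

end Compression

/-! ### Orthonormal bases as orthogonal matrices -/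

section OrthogonalMatrices

/-- Where the quadratic form of an operator with positive semidefinite symmetric part vanishes, the
operator is skew-symmetric against all vectors. -/
theorem LinearMap.IsPositive.inner_eq_neg_inner_of_inner_self_eq_zero {E : Type*}
    [NormedAddCommGroup E] [InnerProductSpace ℝ E] [FiniteDimensional ℝ E] {T : E →ₗ[ℝ] E}
    (hT : (T + LinearMap.adjoint T).IsPositive) {x : E} (hx : ⟪x, T x⟫_ℝ = 0) (z : E) :
    ⟪z, T x⟫_ℝ = -⟪x, T z⟫_ℝ := by
  have h : (T + LinearMap.adjoint T) x = 0 := by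
    refine hT.apply_eq_zero_of_inner_eq_zero ?_
    rw [LinearMap.add_apply, inner_add_left, LinearMap.adjoint_inner_left, real_inner_comm, hx,
      add_zero]
  have h' : ⟪z, (T + LinearMap.adjoint T) x⟫_ℝ = 0 := by rw [h, inner_zero_right]
  rw [LinearMap.add_apply, inner_add_right, LinearMap.adjoint_inner_right,
    real_inner_comm x (T z)] at h'
  linarith

variable {ι κ : Type*} [Fintype ι] [Fintype κ] [DecidableEq κ]

/-- The matrix whose columns are the vectors of an orthonormal basis. -/
noncomputable def OrthonormalBasis.colMatrix (b : OrthonormalBasis ι ℝ (EuclideanSpace ℝ ι)) :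
    Matrix ι ι ℝ :=
  Matrix.of fun i j => b j i

theorem OrthonormalBasis.transpose_colMatrix_mul_mul_apply
    (p : OrthonormalBasis ι ℝ (EuclideanSpace ℝ ι)) (M : Matrix ι κ ℝ)
    (q : OrthonormalBasis κ ℝ (EuclideanSpace ℝ κ)) (i : ι) (j : κ) :
    (p.colMatrixᵀ * M * q.colMatrix) i j = ⟪p i, toEuclideanLin M (q j)⟫_ℝ := by
  rw [Matrix.mul_assoc]
  simp only [mul_apply, transpose_apply, colMatrix, of_apply, PiLp.inner_apply,
    toLpLin_apply, mulVec, dotProduct]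
  refine Finset.sum_congr rfl fun a _ => ?_
  simp [mul_comm]

theorem OrthonormalBasis.colMatrix_mem_orthogonalGroup [DecidableEq ι]
    (b : OrthonormalBasis ι ℝ (EuclideanSpace ℝ ι)) :
    b.colMatrix ∈ Matrix.orthogonalGroup ι ℝ := by
  rw [mem_orthogonalGroup_iff']
  ext i j
  have := b.transpose_colMatrix_mul_mul_apply 1 b i j
  rw [Matrix.mul_one] at this
  rw [this, toEuclideanLin, toLpLin_one, LinearMap.id_apply, Matrix.one_apply,
    orthonormal_iff_ite.1 b.orthonormal]

theorem fromBlocks_mem_orthogonalGroup [DecidableEq ι] {P : Matrix ι ι ℝ} {Q : Matrix κ κ ℝ}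
    (hP : P ∈ Matrix.orthogonalGroup ι ℝ) (hQ : Q ∈ Matrix.orthogonalGroup κ ℝ) :
    fromBlocks P 0 0 Q ∈ Matrix.orthogonalGroup (ι ⊕ κ) ℝ := by
  rw [mem_orthogonalGroup_iff] at *
  simp [fromBlocks_transpose, fromBlocks_multiply, hP, hQ]

theorem finrank_range_toEuclideanLin (M : Matrix ι κ ℝ) :
    finrank ℝ (LinearMap.range (toEuclideanLin M)) = M.rank := by
  rw [toEuclideanLin_eq_toLin_orthonormal]
  exact (rank_eq_finrank_range_toLin M _ _).symm

/-- An orthonormal basis that ends with a basis of the kernel of `M`. -/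
theorem exists_orthonormalBasis_ker {M : Matrix ι κ ℝ} {k l : ℕ} (hM : M.rank = k)
    (h : k + l = Fintype.card κ) :
    ∃ v : OrthonormalBasis (Fin k ⊕ Fin l) ℝ (EuclideanSpace ℝ κ),
      span ℝ (Set.range fun i => v (.inl i)) = (LinearMap.ker (toEuclideanLin M))ᗮ ∧
      ∀ j, toEuclideanLin M (v (.inr j)) = 0 := by
  set X := LinearMap.ker (toEuclideanLin M) with hX
  have hrank := finrank_range_toEuclideanLin M
  have h1 := (toEuclideanLin M).finrank_range_add_finrank_ker
  have h2 := X.finrank_add_finrank_orthogonal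
  have h3 := Xᗮ.finrank_add_finrank_orthogonal
  rw [finrank_euclideanSpace] at h1 h2 h3
  rw [← hX] at h1
  let b := (stdOrthonormalBasis ℝ Xᗮ).reindex (finCongr (by omega : _ = k))
  let c := (stdOrthonormalBasis ℝ Xᗮᗮ).reindex (finCongr (by omega : _ = l))
  obtain ⟨v, hv1, hv2⟩ := b.exists_sum_orthogonal c
  refine ⟨v, ?_, fun j => ?_⟩
  · simp only [hv1, b.span_range_coe]
  · rw [hv2]
    exact (orthogonal_orthogonal X).le (coe_mem _)

/-- If `Cᵀ B` has the same rank as `B`, the two have the same kernel, so the range of `B` meets the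
orthogonal complement of the range of `C` trivially. -/
theorem toEuclideanLin_eq_zero_of_inner_range {o : Type*} [Fintype o] [DecidableEq o]
    {B : Matrix ι κ ℝ} {C : Matrix ι o ℝ} (h : (Cᵀ * B).rank = B.rank) {x : EuclideanSpace ℝ κ}
    (hx : ∀ y ∈ LinearMap.range (toEuclideanLin C), ⟪y, toEuclideanLin B x⟫_ℝ = 0) :
    toEuclideanLin B x = 0 := by
  have hle : LinearMap.ker B.mulVecLin ≤ LinearMap.ker (Cᵀ * B).mulVecLin := by
    rw [mulVecLin_mul]
    exact LinearMap.ker_le_ker_comp _ _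
  have heq : LinearMap.ker B.mulVecLin = LinearMap.ker (Cᵀ * B).mulVecLin := by
    refine eq_of_le_of_finrank_eq hle ?_
    have h1 := B.mulVecLin.finrank_range_add_finrank_ker
    have h2 := (Cᵀ * B).mulVecLin.finrank_range_add_finrank_ker
    simp only [rank] at h
    omega
  have hmem : x.ofLp ∈ LinearMap.ker (Cᵀ * B).mulVecLin := by
    rw [LinearMap.mem_ker, mulVecLin_apply]
    ext i
    have := hx _ ⟨EuclideanSpace.single i 1, rfl⟩
    rw [EuclideanSpace.inner_eq_star_dotProduct, toLpLin_apply, toLpLin_apply] at this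
    rw [← mulVec_mulVec, Pi.zero_apply, ← this, dotProduct_comm]
    simp [mulVec]
    rfl
  rw [← heq, LinearMap.mem_ker, mulVecLin_apply] at hmem
  rw [toLpLin_apply, hmem]
  rfl

end OrthogonalMatrices

/-! ### Orthogonal congruence when `Cᵀ B` has full rank -/

section Congruence

/-- If `Cᵀ B` has rank `k`, block diagonal transformations that act on `A` by congruence lead to the
condensed form: the first `k` columns of `Q₁` span the range of `C`, the others decompose the
compression of `A` to the orthogonal complement of this range. -/
theorem exists_condensed_of_rank_eq {n m k : ℕ} {A : Matrix (Fin n) (Fin n) ℝ}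
    {B C : Matrix (Fin n) (Fin m) ℝ} (hA : (A + Aᵀ).PosSemidef) (hB : B.rank = k)
    (hC : C.rank = k) (hCB : (Cᵀ * B).rank = k) :
    ∃ Q₁ ∈ Matrix.orthogonalGroup (Fin n) ℝ, ∃ Q₂ ∈ Matrix.orthogonalGroup (Fin m) ℝ,
    ∃ V₂ ∈ Matrix.orthogonalGroup (Fin m) ℝ, ∃ D : CondensedBlocks n m k,
      (fromBlocks Q₁ 0 0 Q₂)ᵀ * saddleMatrix A B C * fromBlocks Q₁ 0 0 V₂ = D.toMatrix ∧
      D.IsCondensed ∧ (B = C → Q₂ = V₂ ∧ D.B₂₁ = 0 ∧ D.B₃₁ = 0 ∧ D.B₄₁ = 0) := by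
  obtain ⟨l, hm⟩ : ∃ l, k + l = m :=
    ⟨m - k, Nat.add_sub_cancel' (by simpa [hB] using B.rank_le_width)⟩
  have hm' : k + l = Fintype.card (Fin m) := by simpa using hm
  -- orthonormal bases adapted to the kernels of `C` and `B`, chosen equal if `B = C`
  obtain ⟨w, v, ⟨hw, hw0⟩, ⟨hv, hv0⟩, hvw⟩ :
      ∃ w v : OrthonormalBasis (Fin k ⊕ Fin l) ℝ (EuclideanSpace ℝ (Fin m)),
        (span ℝ (Set.range fun i => w (.inl i)) = (LinearMap.ker (toEuclideanLin C))ᗮ ∧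
          ∀ j, toEuclideanLin C (w (.inr j)) = 0) ∧
        (span ℝ (Set.range fun i => v (.inl i)) = (LinearMap.ker (toEuclideanLin B))ᗮ ∧
          ∀ j, toEuclideanLin B (v (.inr j)) = 0) ∧ (B = C → w = v) := by
    obtain ⟨w, hw⟩ := exists_orthonormalBasis_ker hC hm'
    by_cases hBC : B = C
    · exact ⟨w, w, hw, hBC ▸ hw, fun _ => rfl⟩
    · obtain ⟨v, hv⟩ := exists_orthonormalBasis_ker hB hm'
      exact ⟨w, v, hw, hv, fun h => absurd h hBC⟩
  set a := toEuclideanLin A with ha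
  -- the symmetric part of `A` is positive
  have hpos : (a + LinearMap.adjoint a).IsPositive := by
    rw [ha, ← toEuclideanLin_conjTranspose_eq_adjoint, ← map_add, isPositive_toEuclideanLin_iff,
      conjTranspose_eq_transpose_of_trivial]
    exact hA
  have hax : ∀ x, 0 ≤ ⟪a x, x⟫_ℝ := by
    intro x
    have := hpos.inner_nonneg_left x
    rw [LinearMap.add_apply, inner_add_left, LinearMap.adjoint_inner_left,
      real_inner_comm (a x) x] at this
    linarith
  -- the range of `C` and its orthogonal complement, on which `A` is compressed
  set X := LinearMap.range (toEuclideanLin C) with hX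
  have hXk : finrank ℝ X = k := (finrank_range_toEuclideanLin C).trans hC
  let y := (stdOrthonormalBasis ℝ X).reindex (finCongr hXk)
  obtain ⟨p, q, r, M, M', b, hM, hMu, hMu', hMskew, hb⟩ := exists_orthonormalBasis_accretive
    (Xᗮ.orthogonalProjectionOnto.toLinearMap ∘ₗ a ∘ₗ Xᗮ.subtype) fun x => by
      change 0 ≤ ⟪Xᗮ.orthogonalProjectionOnto (a x), x⟫_ℝ
      rw [inner_orthogonalProjectionOnto_eq_of_mem_right]
      exact hax x
  replace hb : ∀ i j, ⟪(b i : EuclideanSpace ℝ (Fin n)), a (b j)⟫_ℝ =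
      fromBlocks M 0 0 (fromBlocks M' 0 0 0) i j := fun i j => by
    rw [← hb, ← inner_orthogonalProjectionOnto_eq_of_mem_left]
    rfl
  obtain ⟨u, hu1, hu2⟩ := y.exists_sum_orthogonal b
  have hn : k + (p + (q + r)) = n := by
    have := Module.finrank_eq_card_basis u.toBasis
    simpa using this.symm
  have huX' : ∀ i x, ⟪u (.inr i), toEuclideanLin C x⟫_ℝ = 0 := fun i x => by
    rw [hu2, real_inner_comm]
    exact (b i).2 _ ⟨x, rfl⟩
  have hspan : span ℝ (Set.range fun i => u (.inl i)) = X := by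
    simp only [hu1, y.span_range_coe]
  -- on the last two blocks the symmetric part of `A` vanishes
  have hskew : ∀ i z, ⟪u (.inr (.inr i)), a z⟫_ℝ = -⟪z, a (u (.inr (.inr i)))⟫_ℝ := by
    intro i z
    have h0 : ⟪u (.inr (.inr i)), a (u (.inr (.inr i)))⟫_ℝ = 0 := by
      rw [hu2, hb]
      rcases i with i | i
      · have := congrFun (congrFun hMskew i) i
        simp only [Matrix.neg_apply, transpose_apply] at this
        change M' i i = 0
        linarith
      · rfl
    rw [hpos.inner_eq_neg_inner_of_inner_self_eq_zero h0, neg_neg]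
  -- invertibility of `B₁₁` and, as `Cᵀ C` has the rank of `C`, of `C₁₁`
  have hunit : ∀ (B' : Matrix (Fin n) (Fin m) ℝ)
      (v' : OrthonormalBasis (Fin k ⊕ Fin l) ℝ (EuclideanSpace ℝ (Fin m))),
      (Cᵀ * B').rank = B'.rank →
      span ℝ (Set.range fun i => v' (.inl i)) = (LinearMap.ker (toEuclideanLin B'))ᗮ →
      IsUnit (Matrix.of fun i j : Fin k =>
        ⟪u (.inl i), toEuclideanLin B' (v' (.inl j))⟫_ℝ) := by
    intro B' v' hr hv'
    refine isUnit_of_inner (v := fun i => v' (.inl i)) (w := fun i => u (.inl i))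
      (v'.orthonormal.comp _ Sum.inl_injective).linearIndependent fun x hx h => ?_
    rw [hv'] at hx
    rw [hspan] at h
    exact inner_self_eq_zero.1 (hx x (toEuclideanLin_eq_zero_of_inner_range hr h))
  let D : CondensedBlocks n m k :=
    { n₂ := p, n₃ := q, n₄ := r, l := l, hn := hn, hm := hm
      A₁₁ := Matrix.of fun i j => ⟪u (.inl i), a (u (.inl j))⟫_ℝ
      A₁₂ := Matrix.of fun i j => ⟪u (.inl i), a (u (.inr (.inl j)))⟫_ℝ
      A₁₃ := Matrix.of fun i j => ⟪u (.inl i), a (u (.inr (.inr (.inl j))))⟫_ℝ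
      A₁₄ := Matrix.of fun i j => ⟪u (.inl i), a (u (.inr (.inr (.inr j))))⟫_ℝ
      A₂₁ := Matrix.of fun i j => ⟪u (.inr (.inl i)), a (u (.inl j))⟫_ℝ
      A₂₂ := M
      A₃₃ := M'
      B₁₁ := Matrix.of fun i j => ⟪u (.inl i), toEuclideanLin B (v (.inl j))⟫_ℝ
      B₂₁ := Matrix.of fun i j => ⟪u (.inr (.inl i)), toEuclideanLin B (v (.inl j))⟫_ℝ
      B₃₁ := Matrix.of fun i j => ⟪u (.inr (.inr (.inl i))), toEuclideanLin B (v (.inl j))⟫_ℝ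
      B₄₁ := Matrix.of fun i j => ⟪u (.inr (.inr (.inr i))), toEuclideanLin B (v (.inl j))⟫_ℝ
      C₁₁ := Matrix.of fun i j => ⟪u (.inl i), toEuclideanLin C (w (.inl j))⟫_ℝ }
  set e := splitFour hn
  set f := splitTwo hm
  refine ⟨(u.reindex e.symm).colMatrix, OrthonormalBasis.colMatrix_mem_orthogonalGroup _,
    (w.reindex f.symm).colMatrix, OrthonormalBasis.colMatrix_mem_orthogonalGroup _,
    (v.reindex f.symm).colMatrix, OrthonormalBasis.colMatrix_mem_orthogonalGroup _, D, ?_,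
    ⟨hunit B v (hCB.trans hB.symm) hv, hunit C w (rank_transpose_mul_self C) hw, hMu, hMu', hMskew,
      hM⟩, fun hBC => ⟨by rw [hvw hBC], ?_, ?_, ?_⟩⟩
  · rw [saddleMatrix, fromBlocks_transpose, fromBlocks_multiply, fromBlocks_multiply]
    simp only [transpose_zero, Matrix.zero_mul, Matrix.mul_zero, add_zero, zero_add]
    ext (i | i) (j | j)
    · change _ = fromBlocks D.A₁₁ (fromCols D.A₁₂ (fromCols D.A₁₃ D.A₁₄))
        (fromRows D.A₂₁ (fromRows (-D.A₁₃ᵀ) (-D.A₁₄ᵀ)))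
        (fromBlocks D.A₂₂ 0 0 (fromBlocks D.A₃₃ 0 0 0)) (e i) (e j)
      rw [fromBlocks_apply₁₁, OrthonormalBasis.transpose_colMatrix_mul_mul_apply,
        OrthonormalBasis.reindex_apply, OrthonormalBasis.reindex_apply, Equiv.symm_symm]
      generalize e i = i'
      generalize e j = j'
      rcases i' with i | i <;> rcases j' with j | j
      · rfl
      · rcases j with j | j | j <;> rfl
      · rcases i with i | i | i
        · rfl
        · exact hskew _ _
        · exact hskew _ _
      · rw [hu2, hu2]
        exact hb i j
    · change _ = fromCols (fromRows D.B₁₁ (fromRows D.B₂₁ (fromRows D.B₃₁ D.B₄₁)))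
        (0 : Matrix _ (Fin l) ℝ) (e i) (f j)
      rw [fromBlocks_apply₁₂, OrthonormalBasis.transpose_colMatrix_mul_mul_apply,
        OrthonormalBasis.reindex_apply, OrthonormalBasis.reindex_apply, Equiv.symm_symm,
        Equiv.symm_symm]
      generalize e i = i'
      generalize f j = j'
      rcases j' with j | j
      · rcases i' with i | i | i | i <;> rfl
      · rw [hv0, inner_zero_right]
        rfl
    · change _ = fromRows (fromCols (-D.C₁₁ᵀ) 0) (0 : Matrix (Fin l) _ ℝ) (f i) (e j)
      rw [fromBlocks_apply₂₁]
      have : (w.reindex f.symm).colMatrixᵀ * -Cᵀ * (u.reindex e.symm).colMatrix =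
          -((u.reindex e.symm).colMatrixᵀ * C * (w.reindex f.symm).colMatrix)ᵀ := by
        simp only [transpose_mul, transpose_transpose, Matrix.mul_neg, Matrix.neg_mul,
          Matrix.mul_assoc]
      rw [this, Matrix.neg_apply, transpose_apply,
        OrthonormalBasis.transpose_colMatrix_mul_mul_apply,
        OrthonormalBasis.reindex_apply, OrthonormalBasis.reindex_apply, Equiv.symm_symm,
        Equiv.symm_symm]
      generalize f i = i'
      generalize e j = j'
      rcases i' with i | i
      · rcases j' with j | j
        · rfl
        · rw [huX', neg_zero]
          rfl
      · rw [hw0, inner_zero_right, neg_zero]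
        rfl
    · rfl
  all_goals
    subst hBC
    ext i j
    exact huX' _ _

end Congruence

/-! ### The singular value decomposition -/

section SingularValues

/-- The singular value decomposition of a real square matrix. -/
theorem exists_singular_bases {ι : Type*} [Fintype ι] [DecidableEq ι] (W : Matrix ι ι ℝ) :
    ∃ (P Q : OrthonormalBasis ι ℝ (EuclideanSpace ℝ ι)) (σ : ι → ℝ), (∀ j, 0 ≤ σ j) ∧
      ∀ j, toEuclideanLin W (Q j) = σ j • P j := by
  set T := toEuclideanLin W with hT
  have hH : (Wᵀ * W).IsHermitian := by
    simpa using isHermitian_conjTranspose_mul_self W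
  let Q := hH.eigenvectorBasis
  have horth : ∀ i j, i ≠ j → ⟪T (Q i), T (Q j)⟫_ℝ = 0 := by
    intro i j hij
    have h1 : LinearMap.adjoint T (T (Q j)) = hH.eigenvalues j • Q j := by
      rw [hT, ← toEuclideanLin_conjTranspose_eq_adjoint, conjTranspose_eq_transpose_of_trivial,
        toLpLin_apply, toLpLin_apply, mulVec_mulVec, hH.mulVec_eigenvectorBasis]
      rfl
    rw [← LinearMap.adjoint_inner_right, h1, real_inner_smul_right, Q.orthonormal.2 hij, mul_zero]
  let s : Set ι := {j | T (Q j) ≠ 0}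
  -- the nonzero images of the eigenvectors of `Wᵀ W`, normalized, are part of the left basis
  let v : ι → EuclideanSpace ℝ ι := fun j => ‖T (Q j)‖⁻¹ • T (Q j)
  have hv : Orthonormal ℝ (s.domRestrict v) := by
    constructor
    · rintro ⟨j, hj⟩
      exact norm_smul_inv_norm (𝕜 := ℝ) hj
    · rintro ⟨i, hi⟩ ⟨j, hj⟩ hij
      change ⟪v i, v j⟫_ℝ = 0
      rw [real_inner_smul_left, real_inner_smul_right, horth i j fun h => hij (Subtype.ext h),
        mul_zero, mul_zero]
  obtain ⟨P, hP⟩ := hv.exists_orthonormalBasis_extension_of_card_eq (by simp)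
  refine ⟨P, Q, fun j => ‖T (Q j)‖, fun j => norm_nonneg _, fun j => ?_⟩
  change T (Q j) = ‖T (Q j)‖ • P j
  by_cases hj : T (Q j) = 0
  · rw [hj, norm_zero, zero_smul]
  · rw [hP j hj, smul_smul, mul_inv_cancel₀ (norm_ne_zero_iff.2 hj), one_smul]

theorem rank_eq_card_singular_ne_zero {ι : Type*} [Fintype ι] [DecidableEq ι] {W : Matrix ι ι ℝ}
    {P Q : OrthonormalBasis ι ℝ (EuclideanSpace ℝ ι)} {σ : ι → ℝ}
    (h : ∀ j, toEuclideanLin W (Q j) = σ j • P j) :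
    W.rank = Fintype.card {j // σ j ≠ 0} := by
  have hd : P.colMatrixᵀ * W * Q.colMatrix = diagonal σ := by
    ext i j
    rw [OrthonormalBasis.transpose_colMatrix_mul_mul_apply, h, real_inner_smul_right,
      orthonormal_iff_ite.1 P.orthonormal, diagonal_apply]
    by_cases hij : i = j <;> simp [hij]
  have hP : IsUnit P.colMatrixᵀ.det := by
    rw [det_transpose, ← isUnit_iff_isUnit_det]
    exact Unitary.isUnit_coe (U := ⟨_, P.colMatrix_mem_orthogonalGroup⟩)
  have hQ : IsUnit Q.colMatrix.det := by
    rw [← isUnit_iff_isUnit_det]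
    exact Unitary.isUnit_coe (U := ⟨_, Q.colMatrix_mem_orthogonalGroup⟩)
  rw [← rank_diagonal, ← hd, rank_mul_eq_left_of_isUnit_det _ _ hQ,
    rank_mul_eq_right_of_isUnit_det _ _ hP]

end SingularValues

/-! ### The rank of a saddle point matrix -/

section SaddleRank

theorem Matrix.rank_add_le_rank_add_rank {ι κ : Type*} [Finite ι] [Fintype κ]
    (M N : Matrix ι κ ℝ) : (M + N).rank ≤ M.rank + N.rank := by
  rw [rank, mulVecLin_add]
  exact (finrank_mono (LinearMap.range_add_le _ _)).trans
    (finrank_add_le_finrank_add_finrank _ _)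

variable {n m : ℕ} (A : Matrix (Fin n) (Fin n) ℝ) (B C : Matrix (Fin n) (Fin m) ℝ)

theorem rank_saddleMatrix_le : (saddleMatrix A B C).rank ≤ n + C.rank := by
  have h : saddleMatrix A B C = fromRows (1 : Matrix (Fin n) (Fin n) ℝ) (0 : Matrix (Fin m) _ ℝ) *
      fromCols A B + fromRows (0 : Matrix (Fin n) _ ℝ) (1 : Matrix (Fin m) (Fin m) ℝ) *
        (Cᵀ * fromCols (-1 : Matrix (Fin n) (Fin n) ℝ) (0 : Matrix (Fin n) (Fin m) ℝ)) := by
    ext (i | i) (j | j) <;> simp [saddleMatrix, fromRows_mul, mul_fromCols]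
  rw [h]
  refine (Matrix.rank_add_le_rank_add_rank _ _).trans (add_le_add ?_ ?_)
  · exact (rank_mul_le_right _ _).trans ((rank_le_card_height _).trans (Fintype.card_fin n).le)
  · exact (rank_mul_le_right _ _).trans ((rank_mul_le_left _ _).trans (rank_transpose C).le)

/-- A kernel vector `(x, y)` has `x` in the kernel of `Cᵀ`, and `y` in the kernel of `B` if `x = 0`;
this bounds the dimension of the kernel. -/
theorem rank_add_rank_le_rank_saddleMatrix : B.rank + C.rank ≤ (saddleMatrix A B C).rank := by
  set W := saddleMatrix A B C with hW
  set N := LinearMap.ker W.mulVecLin with hN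
  have hmem : ∀ z ∈ N, A *ᵥ (z ∘ Sum.inl) + B *ᵥ (z ∘ Sum.inr) = 0 ∧ Cᵀ *ᵥ (z ∘ Sum.inl) = 0 := by
    intro z hz
    rw [hN, LinearMap.mem_ker, mulVecLin_apply, hW, saddleMatrix, fromBlocks_mulVec] at hz
    constructor
    · ext i
      exact congrFun hz (.inl i)
    · ext i
      have := congrFun hz (.inr i)
      simpa [neg_mulVec] using this
  let g : (Fin n ⊕ Fin m → ℝ) →ₗ[ℝ] (Fin n → ℝ) := LinearMap.funLeft ℝ ℝ Sum.inl
  let h : (Fin m → ℝ) →ₗ[ℝ] (Fin n ⊕ Fin m → ℝ) :=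
    (LinearEquiv.sumArrowLequivProdArrow (Fin n) (Fin m) ℝ ℝ).symm.toLinearMap ∘ₗ
      LinearMap.inr ℝ _ _
  have h1 := (g.domRestrict N).finrank_range_add_finrank_ker
  have h2 : finrank ℝ (LinearMap.range (g.domRestrict N)) ≤
      finrank ℝ (LinearMap.ker Cᵀ.mulVecLin) := by
    refine finrank_mono ?_
    rintro _ ⟨⟨z, hz⟩, rfl⟩
    exact (hmem z hz).2
  have h3 : finrank ℝ (LinearMap.ker (g.domRestrict N)) ≤
      finrank ℝ (LinearMap.ker B.mulVecLin) := by
    rw [← finrank_map_subtype_eq]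
    refine (finrank_mono ?_).trans (finrank_map_le h (LinearMap.ker B.mulVecLin))
    rintro _ ⟨⟨z, hz⟩, hz', rfl⟩
    have h0 : z ∘ Sum.inl = 0 := hz'
    refine ⟨z ∘ Sum.inr, ?_, ?_⟩
    · have := (hmem z hz).1
      rwa [h0, mulVec_zero, zero_add] at this
    · ext (i | i)
      · exact (congrFun h0 i).symm
      · rfl
  have hrW := W.mulVecLin.finrank_range_add_finrank_ker
  have hrB := B.mulVecLin.finrank_range_add_finrank_ker
  have hrC := Cᵀ.mulVecLin.finrank_range_add_finrank_ker
  have hC : Cᵀ.rank = C.rank := rank_transpose C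
  rw [← hN] at hrW
  simp only [rank, finrank_fintype_fun_eq_card, Fintype.card_sum, Fintype.card_fin] at *
  omega

end SaddleRank

/-! ### The condensed form through singular values -/

section SingularValueForm

/-- The permutation of a sum type that exchanges the two copies of the first summand. -/
def swapInl (α β γ : Type*) : (α ⊕ β) ⊕ (α ⊕ γ) ≃ (α ⊕ β) ⊕ (α ⊕ γ) where
  toFun
    | .inl (.inl a) => .inr (.inl a)
    | .inl (.inr b) => .inl (.inr b)
    | .inr (.inl a) => .inl (.inl a)
    | .inr (.inr c) => .inr (.inr c)
  invFun
    | .inl (.inl a) => .inr (.inl a)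
    | .inl (.inr b) => .inl (.inr b)
    | .inr (.inl a) => .inl (.inl a)
    | .inr (.inr c) => .inr (.inr c)
  left_inv := by rintro ((_ | _) | (_ | _)) <;> rfl
  right_inv := by rintro ((_ | _) | (_ | _)) <;> rfl

/-- Indices can be sorted so that a predicate holds exactly on prescribed blocks. -/
theorem exists_equiv_blocks {ι : Type*} [Fintype ι] (p : ι → Prop) [DecidablePred p]
    {a b c d : ℕ} (h1 : Fintype.card {i // p i} = (a + b) + a)
    (h2 : Fintype.card {i // ¬ p i} = c + d) :
    ∃ g : (Fin a ⊕ (Fin b ⊕ (Fin 0 ⊕ Fin c))) ⊕ (Fin a ⊕ Fin d) ≃ ι,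
      (∀ i, p (g (.inl (.inl i)))) ∧ (∀ i, p (g (.inl (.inr (.inl i))))) ∧
      (∀ i, ¬ p (g (.inl (.inr (.inr (.inr i)))))) ∧ (∀ i, p (g (.inr (.inl i)))) ∧
      ∀ i, ¬ p (g (.inr (.inr i))) := by
  obtain ⟨e1⟩ : Nonempty ((Fin a ⊕ Fin b) ⊕ Fin a ≃ {i // p i}) :=
    Fintype.card_eq.1 (by simp [h1])
  obtain ⟨e2⟩ : Nonempty (Fin c ⊕ Fin d ≃ {i // ¬ p i}) := Fintype.card_eq.1 (by simp [h2])
  let r : (Fin a ⊕ (Fin b ⊕ (Fin 0 ⊕ Fin c))) ⊕ (Fin a ⊕ Fin d) ≃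
      ((Fin a ⊕ Fin b) ⊕ Fin a) ⊕ (Fin c ⊕ Fin d) :=
    { toFun := fun
        | .inl (.inl i) => .inl (.inl (.inl i))
        | .inl (.inr (.inl i)) => .inl (.inl (.inr i))
        | .inl (.inr (.inr (.inr i))) => .inr (.inl i)
        | .inr (.inl i) => .inl (.inr i)
        | .inr (.inr i) => .inr (.inr i)
      invFun := fun
        | .inl (.inl (.inl i)) => .inl (.inl i)
        | .inl (.inl (.inr i)) => .inl (.inr (.inl i))
        | .inr (.inl i) => .inl (.inr (.inr (.inr i)))
        | .inl (.inr i) => .inr (.inl i)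
        | .inr (.inr i) => .inr (.inr i)
      left_inv := by
        rintro ((i | i | i | i) | (i | i))
        case inl.inr.inr.inl => exact i.elim0
        all_goals rfl
      right_inv := by rintro (((i | i) | i) | (i | i)) <;> rfl }
  exact ⟨r.trans ((Equiv.sumCongr e1 e2).trans (Equiv.sumCompl p)), fun i => (e1 _).2,
    fun i => (e1 _).2, fun i => (e2 _).2, fun i => (e1 _).2, fun i => (e2 _).2⟩

/-- With independent orthogonal transformations on the two sides only the singular values matter.
There are between `2 k` and `n + k` nonzero ones; `k` of them fill `B₁₁`, `k` of them `C₁₁`, and the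
others the positive definite diagonal block `A₂₂`. -/
theorem exists_condensed_singular {n m k : ℕ} (A : Matrix (Fin n) (Fin n) ℝ)
    {B C : Matrix (Fin n) (Fin m) ℝ} (hB : B.rank = k) (hC : C.rank = k) :
    ∃ Q ∈ Matrix.orthogonalGroup (Fin n ⊕ Fin m) ℝ,
    ∃ V ∈ Matrix.orthogonalGroup (Fin n ⊕ Fin m) ℝ, ∃ D : CondensedBlocks n m k,
      Qᵀ * saddleMatrix A B C * V = D.toMatrix ∧ D.IsCondensed := by
  classical
  have hr1 := rank_saddleMatrix_le A B C
  have hr2 := rank_add_rank_le_rank_saddleMatrix A B C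
  have hm := B.rank_le_width
  obtain ⟨P, Q, σ, hσ, hPQ⟩ := exists_singular_bases (saddleMatrix A B C)
  have hcard := rank_eq_card_singular_ne_zero hPQ
  have hcard' := Fintype.card_subtype_compl fun j => σ j ≠ 0
  rw [← hcard, Fintype.card_sum, Fintype.card_fin, Fintype.card_fin] at hcard'
  obtain ⟨p, hp⟩ : ∃ p, (saddleMatrix A B C).rank = (k + p) + k :=
    ⟨(saddleMatrix A B C).rank - k - k, by omega⟩
  obtain ⟨r, hn⟩ : ∃ r, k + (p + (0 + r)) = n := ⟨n - k - p, by omega⟩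
  obtain ⟨l, hm⟩ : ∃ l, k + l = m := ⟨m - k, by omega⟩
  obtain ⟨g, hg1, hg2, hg4, hg5, hg6⟩ := exists_equiv_blocks (fun j => σ j ≠ 0)
    (a := k) (b := p) (c := r) (d := l) (hcard.symm.trans hp) (by omega)
  simp only [not_not] at hg4 hg6
  have hpos : ∀ {j}, σ j ≠ 0 → 0 < σ j := fun h => lt_of_le_of_ne (hσ _) h.symm
  let s := swapInl (Fin k) (Fin p ⊕ (Fin 0 ⊕ Fin r)) (Fin l)
  -- the permutation `s` of the columns moves the singular values to the blocks of `B₁₁` and `C₁₁`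
  have hent : ∀ t t', ⟪P (g t), toEuclideanLin (saddleMatrix A B C) (Q (g (s t')))⟫_ℝ =
      if t = s t' then σ (g t) else 0 := by
    intro t t'
    rw [hPQ, real_inner_smul_right, orthonormal_iff_ite.1 P.orthonormal]
    by_cases h : t = s t'
    · simp [h]
    · have : g t ≠ g (s t') := fun h' => h (g.injective h')
      simp [h, this]
  let D : CondensedBlocks n m k :=
    { n₂ := p, n₃ := 0, n₄ := r, l := l, hn := hn, hm := hm
      A₁₁ := 0, A₁₂ := 0, A₁₃ := 0, A₁₄ := 0, A₂₁ := 0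
      A₂₂ := diagonal fun i => σ (g (.inl (.inr (.inl i))))
      A₃₃ := 0
      B₁₁ := diagonal fun i => σ (g (.inl (.inl i)))
      B₂₁ := 0, B₃₁ := 0, B₄₁ := 0
      C₁₁ := -diagonal fun i => σ (g (.inr (.inl i))) }
  have hunit : ∀ {N : ℕ} {w : Fin N → ℝ}, (∀ i, w i ≠ 0) → IsUnit (diagonal w) := fun hw => by
    rw [isUnit_diagonal, Pi.isUnit_iff]
    exact fun i => (hw i).isUnit
  let E := Equiv.sumCongr (splitFour hn) (splitTwo hm)
  refine ⟨(P.reindex (E.trans g).symm).colMatrix, OrthonormalBasis.colMatrix_mem_orthogonalGroup _,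
    (Q.reindex (E.trans (s.trans g)).symm).colMatrix,
    OrthonormalBasis.colMatrix_mem_orthogonalGroup _, D, ?_,
    ⟨hunit hg1, (hunit hg5).neg, hunit hg2, isUnit_of_subsingleton _, Subsingleton.elim _ _,
      (PosDef.diagonal fun i => hpos (hg2 i)).isStaircase⟩⟩
  ext i j
  rw [OrthonormalBasis.transpose_colMatrix_mul_mul_apply, OrthonormalBasis.reindex_apply,
    OrthonormalBasis.reindex_apply, Equiv.symm_symm, Equiv.symm_symm]
  simp only [Equiv.trans_apply]
  rw [hent, CondensedBlocks.toMatrix, submatrix_apply]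
  change (if E i = s (E j) then σ (g (E i)) else 0) = fromBlocks _ _ _ _ (E i) (E j)
  generalize E i = t
  generalize E j = t'
  rcases t with (i | i | i | i) | (i | i) <;> rcases t' with (j | j | j | j) | (j | j) <;>
    first
    | exact i.elim0
    | exact j.elim0
    | simp [s, swapInl, D, hg4, hg6, diagonal_apply, eq_comm]

end SingularValueForm

end Preparation

/-! ### The condensed form -/

theorem mulVec_eq_iff_of_orthogonal {ι : Type*} [Fintype ι] [DecidableEq ι] {Q V W M : Matrix ι ι ℝ}
    (hQ : Q ∈ Matrix.orthogonalGroup ι ℝ) (hV : V ∈ Matrix.orthogonalGroup ι ℝ)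
    (h : Qᵀ * W * V = M) (z w : ι → ℝ) : W *ᵥ z = w ↔ M *ᵥ (Vᵀ *ᵥ z) = Qᵀ *ᵥ w := by
  have hM : M *ᵥ (Vᵀ *ᵥ z) = Qᵀ *ᵥ (W *ᵥ z) := by
    rw [mulVec_mulVec, mulVec_mulVec, ← h, Matrix.mul_assoc (Qᵀ * W),
      (Matrix.mem_orthogonalGroup_iff ι ℝ).1 hV, Matrix.mul_one]
  rw [hM]
  refine ⟨fun h' => by rw [h'], fun h' => ?_⟩
  have := congrArg (Q *ᵥ ·) h'
  simpa [mulVec_mulVec, ← Matrix.mul_assoc, (Matrix.mem_orthogonalGroup_iff ι ℝ).1 hQ] using this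

theorem theorem2p3 (n m k : ℕ) (A : Matrix (Fin n) (Fin n) ℝ) (B C : Matrix (Fin n) (Fin m) ℝ)
    (hA : (A + Aᵀ).PosSemidef) (hB : B.rank = k) (hC : C.rank = k) :
    ∃ Q ∈ Matrix.orthogonalGroup (Fin n ⊕ Fin m) ℝ,
    ∃ V ∈ Matrix.orthogonalGroup (Fin n ⊕ Fin m) ℝ,
    ∃ D : CondensedBlocks n m k,
      -- the condensed form and the properties of its blocks
      Qᵀ * saddleMatrix A B C * V = D.toMatrix ∧
      D.IsCondensed ∧
      -- the linear system in the transformed variables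
      (∀ (x f : Fin n → ℝ) (y g : Fin m → ℝ),
        saddleMatrix A B C *ᵥ Sum.elim x y = Sum.elim f g ↔
          D.toMatrix *ᵥ (Vᵀ *ᵥ Sum.elim x y) = Qᵀ *ᵥ Sum.elim f g) ∧
      -- block diagonal transformations, with an orthogonal congruence on the block `A`
      ((Cᵀ * B).rank = k →
        ∃ Q₁ ∈ Matrix.orthogonalGroup (Fin n) ℝ,
        ∃ Q₂ ∈ Matrix.orthogonalGroup (Fin m) ℝ,
        ∃ V₂ ∈ Matrix.orthogonalGroup (Fin m) ℝ,
          Q = Matrix.fromBlocks Q₁ 0 0 Q₂ ∧ V = Matrix.fromBlocks Q₁ 0 0 V₂) ∧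
      -- the symmetric and the generalized case
      (B = C → Q = V ∧ D.B₂₁ = 0 ∧ D.B₃₁ = 0 ∧ D.B₄₁ = 0) := by
  by_cases hCB : (Cᵀ * B).rank = k
  · obtain ⟨Q₁, hQ₁, Q₂, hQ₂, V₂, hV₂, D, hD, hcond, hBC⟩ :=
      exists_condensed_of_rank_eq hA hB hC hCB
    have hQ := fromBlocks_mem_orthogonalGroup hQ₁ hQ₂
    have hV := fromBlocks_mem_orthogonalGroup hQ₁ hV₂
    refine ⟨_, hQ, _, hV, D, hD, hcond,
      fun x f y g => mulVec_eq_iff_of_orthogonal hQ hV hD _ _,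
      fun _ => ⟨Q₁, hQ₁, Q₂, hQ₂, V₂, hV₂, rfl, rfl⟩, fun h => ?_⟩
    obtain ⟨h2, h3⟩ := hBC h
    exact ⟨by rw [h2], h3⟩
  · obtain ⟨Q, hQ, V, hV, D, hD, hcond⟩ := exists_condensed_singular A hB hC
    refine ⟨Q, hQ, V, hV, D, hD, hcond,
      fun x f y g => mulVec_eq_iff_of_orthogonal hQ hV hD _ _, fun h => absurd h hCB, fun h => ?_⟩
    -- `Cᵀ C` has the rank of `C`, so this case does not occur for `B = C`
    subst h
    exact absurd ((rank_transpose_mul_self B).trans hB) hCB
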